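/- Let $G$ be a causal diagram, i.e. a finite directed acyclic graph on a set $V$ of variables. A structural model on $G$ consists of measurable structural equations $X_v=f_v(pa_v,\varepsilon_v)$, $v\in V$, where $pa_v$ is the vector of the parents of $X_v$ in $G$, the variables and disturbances take values in standard Borel spaces, and the disturbances $\varepsilon_v$ are mutually independent; counterfactuals are obtained by recursive substitution. Let $A\neq Y$ be nodes of $G$ (exposure and outcome), and write $Y_a$ for the value of $Y$ when the equation of $A$ is replaced by the constant $a$. Let $P\subseteq V\setminus\{A,Y\}$ be the set of pre-exposure covariates; it contains every ancestor of $A$ (so $Y$ is not an ancestor of $A$) and no descendant of $A$. (For instance, when $Y$ is not an ancestor of $A$, $P$ may be the set of all nondescendants of $A$ other than $A$ and $Y$.) A set $S$ of variables is called a sufficient adjustment set on $G$ if $Y_a\perp\!\!\!\perp A\mid S$ for every value $a$ in every structural model on $G$. A set $S\subseteq P$ is called minimally sufficient if it is sufficient and no proper subset of $S$ is sufficient. A variable $C\in P$ is called a confounder for the effect of $A$ on $Y$ if it belongs to some minimally sufficient adjustment set $S\subseteq P$. Proposition 4. For every causal diagram $G$ and all $A$, $Y$, $P$ as above: (Property 1)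 the set of all confounders is a sufficient adjustment set; equivalently, the union of all minimally sufficient adjustment sets $S\subseteq P$ is a sufficient adjustment set; (Property 2A) for every confounder $C$ there is a (possibly empty) set $X\subseteq P$ such that $X\cup\{C\}$ is a sufficient adjustment set but $X$ is not. -/

import Mathlib

open MeasureTheory ProbabilityTheory

noncomputable section

universe u

/-- A causal diagram: a directed acyclic graph on the set `V` of variables. -/
structure CausalDiagram (V : Type u) extends Digraph V where
  acyclic : ∀ v, ¬ Relation.TransGen Adj v v

namespace CausalDiagram

variable {V : Type u}

/-- `u` is a (proper) ancestor of `v`, i.e. `v` is a (proper) descendant of `u`: there is a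
directed path with at least one edge from `u` to `v`. -/
def IsAncestor (G : CausalDiagram V) (u v : V) : Prop := Relation.TransGen G.Adj u v

theorem wellFounded_adj [Finite V] (G : CausalDiagram V) : WellFounded G.Adj := by
  have : Std.Irrefl (Relation.TransGen G.Adj) := ⟨G.acyclic⟩
  exact Subrelation.wf (fun h => Relation.TransGen.single h)
    (Finite.wellFounded_of_trans_of_irrefl (Relation.TransGen G.Adj))

end CausalDiagram

/-- A system of nonparametric structural equations `X_v = f_v (pa_v, ε_v)` on the diagram `G`.
The variables and the disturbances take values in standard Borel spaces, and the disturbances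
`ε_v` have the laws `noiseLaw v`; they are made mutually independent in `law` below. -/
structure StructuralModel {V : Type u} (G : CausalDiagram V) where
  Val : V → Type
  [measVal : ∀ v, MeasurableSpace (Val v)]
  [borelVal : ∀ v, StandardBorelSpace (Val v)]
  Noise : V → Type
  [measNoise : ∀ v, MeasurableSpace (Noise v)]
  [borelNoise : ∀ v, StandardBorelSpace (Noise v)]
  noiseLaw : ∀ v, Measure (Noise v)
  [probNoise : ∀ v, IsProbabilityMeasure (noiseLaw v)]
  f : ∀ v, (∀ p : {p // G.Adj p v}, Val p) → Noise v → Val v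
  measurable_f : ∀ v, Measurable (Function.uncurry (f v))

namespace StructuralModel

attribute [instance] measVal borelVal measNoise borelNoise probNoise

variable {V : Type u} [Fintype V] {G : CausalDiagram V}

/-- The space of all disturbance vectors `(ε_v)_v`. -/
abbrev Ω (M : StructuralModel G) : Type u := ∀ v, M.Noise v

/-- The joint law of the mutually independent disturbances. -/
def law (M : StructuralModel G) : Measure M.Ω := Measure.pi M.noiseLaw

instance (M : StructuralModel G) : IsProbabilityMeasure M.law := by
  unfold law; infer_instance

/-- Recursive substitution: the solution of the equations `x_v = F_v (pa_v)`. -/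
def solve (M : StructuralModel G)
    (F : ∀ v, (∀ p : {p // G.Adj p v}, M.Val p) → M.Val v) : ∀ v, M.Val v :=
  G.wellFounded_adj.fix fun v ih => F v fun p => ih p.1 p.2

theorem solve_eq (M : StructuralModel G)
    (F : ∀ v, (∀ p : {p // G.Adj p v}, M.Val p) → M.Val v) (v : V) :
    M.solve F v = F v fun p => M.solve F p.1 :=
  G.wellFounded_adj.fix_eq _ v

/-- The actual value of the variable `v`, as a random variable on the disturbance space. -/
def X (M : StructuralModel G) (v : V) (ε : M.Ω) : M.Val v :=
  M.solve (fun w pa => M.f w pa (ε w)) v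

open Classical in
/-- The counterfactual value of the variable `v` if the variable `A` were set to `a`: the
structural equation of `A` is replaced by the constant `a`, all others are kept. -/
def potential (M : StructuralModel G) (A : V) (a : M.Val A) (v : V) (ε : M.Ω) : M.Val v :=
  M.solve (Function.update (fun w pa => M.f w pa (ε w)) A fun _ => a) v

theorem measurable_X (M : StructuralModel G) (v : V) : Measurable (M.X v) := by
  induction v using G.wellFounded_adj.induction with
  | _ v ih =>
    have h : M.X v = fun ε => Function.uncurry (M.f v)
        (fun p : {p // G.Adj p v} => M.X p.1 ε, ε v) := by
      funext ε
      exact M.solve_eq _ v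
    rw [h]
    exact (M.measurable_f v).comp
      ((measurable_pi_lambda _ fun p => ih p.1 p.2).prodMk (measurable_pi_apply v))

/-- The vector of the actual values of the variables in `S`. -/
def XOn (M : StructuralModel G) (S : Set V) (ε : M.Ω) : ∀ s : S, M.Val s := fun s => M.X s ε

theorem measurable_XOn (M : StructuralModel G) (S : Set V) : Measurable (M.XOn S) :=
  measurable_pi_lambda _ fun s => M.measurable_X s

/-- No confounding of the effect of `A` on `Y` conditional on `S` in the structural model `M`:
for every value `a`, the potential outcome `Y_a` and `A` are conditionally independent given `S`. -/
def Unconfounded (M : StructuralModel G) (A Y : V) (S : Set V) : Prop :=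
  ∀ a : M.Val A, CondIndepFun (MeasurableSpace.comap (M.XOn S) inferInstance)
    (M.measurable_XOn S).comap_le (M.potential A a Y) (M.X A) M.law

end StructuralModel

namespace CausalDiagram

variable {V : Type u} [Fintype V]

/-- `S` is a sufficient adjustment set on the diagram `G`: the nonparametric causal model
represented by `G` entails `Y_a ⊥ A | S`, i.e. this independence holds for all structural
equations and all laws of the disturbances on `G`. -/
def Sufficient (G : CausalDiagram V) (A Y : V) (S : Set V) : Prop :=
  ∀ M : StructuralModel G, M.Unconfounded A Y S

/-- `P` can serve as the set of all pre-exposure covariates for the exposure `A` and the outcome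
`Y`: neither `A` nor `Y` is a covariate, all causes of `A` precede `A`, and no effect of `A`
precedes `A`. The set of all variables that are temporally prior to the exposure and the set of all
nondescendants of `A` other than `A` and `Y` are of this form (for an outcome that is not itself a
cause of the exposure). -/
structure IsPreExposure (G : CausalDiagram V) (A Y : V) (P : Set V) : Prop where
  exposure_notMem : A ∉ P
  outcome_notMem : Y ∉ P
  ancestor_mem : ∀ C, G.IsAncestor C A → C ∈ P
  not_descendant : ∀ C ∈ P, ¬ G.IsAncestor A C

/-- `S` is a minimally sufficient adjustment set of pre-exposure covariates: it is sufficient and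
no proper subset of it is. -/
def MinimallySufficient (G : CausalDiagram V) (A Y : V) (P S : Set V) : Prop :=
  S ⊆ P ∧ G.Sufficient A Y S ∧ ∀ T, T ⊂ S → ¬ G.Sufficient A Y T

/-- `C` is a confounder for the effect of `A` on `Y`: a pre-exposure covariate that is a member of
some minimally sufficient adjustment set. -/
def IsConfounder (G : CausalDiagram V) (A Y : V) (P : Set V) (C : V) : Prop :=
  C ∈ P ∧ ∃ S, G.MinimallySufficient A Y P S ∧ C ∈ S

/-- The property that the set of all confounders, in the sense of the predicate `conf`, is a
sufficient adjustment set. -/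
def ConfoundersSuffice (G : CausalDiagram V) (A Y : V) (conf : V → Prop) : Prop :=
  G.Sufficient A Y {C | conf C}

/-- The property that every confounder, in the sense of the predicate `conf`, helps to eliminate
confounding in the context of some (possibly empty) set `X` of pre-exposure covariates. -/
def ConfoundersEliminateBias (G : CausalDiagram V) (A Y : V) (P : Set V)
    (conf : V → Prop) : Prop :=
  ∀ C, conf C → ∃ X, X ⊆ P ∧ G.Sufficient A Y (insert C X) ∧ ¬ G.Sufficient A Y X

end CausalDiagram

end

/-! Sufficiency quantifies over all structural models on `G`, so it can be used by feeding a
sufficient set a model built for the purpose; no d-separation is needed. Freezing: making the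
equations outside a parent-closed set `B` containing `A` and `Y` constant leaves everything inside
`B` unchanged and makes conditioning outside `B` vacuous. Hence a sufficient `S` can be cut down to
`S ∩ B` (`Sufficient.inter_ancestral`), and minimally sufficient sets consist of ancestors of `A` or
`Y`, these nodes included. Broadcasting: if `t` is a nondescendant of `A` and such an ancestor,
copies of `X_t` can be passed along directed paths until they reach `S`, `A` or `Y`. Sufficiency of
`S` in the enlarged model yields sufficiency of `S ∪ {t}` in the original one, by weak union if the
copy arrives at `A` or `Y` (`Sufficient.insert`). The parents of `A` are sufficient, so some
minimally sufficient `S₀` exists; adding the members of the other minimally sufficient sets one at a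
time keeps sufficiency, which gives Property 1. Property 2A is minimality itself. -/

/-! ### Conditional independence as a Markov property -/

namespace MeasurableSpace

/-- The join of two `σ`-algebras is generated by the intersections of their members. -/
theorem sup_eq_generateFrom_inter {Ω : Type*} (m₁ m₂ : MeasurableSpace Ω) :
    m₁ ⊔ m₂ = generateFrom {s | ∃ u v, MeasurableSet[m₁] u ∧ MeasurableSet[m₂] v ∧ u ∩ v = s} := by
  apply le_antisymm
  · refine sup_le (fun u hu => ?_) (fun v hv => ?_)
    · exact measurableSet_generateFrom ⟨u, Set.univ, hu, MeasurableSet.univ, Set.inter_univ u⟩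
    · exact measurableSet_generateFrom ⟨Set.univ, v, MeasurableSet.univ, hv, Set.univ_inter v⟩
  · refine generateFrom_le ?_
    rintro _ ⟨u, v, hu, hv, rfl⟩
    exact MeasurableSet.inter (m := m₁ ⊔ m₂) ((le_sup_left : m₁ ≤ m₁ ⊔ m₂) u hu)
      ((le_sup_right : m₂ ≤ m₁ ⊔ m₂) v hv)

theorem isPiSystem_inter {Ω : Type*} (m₁ m₂ : MeasurableSpace Ω) :
    IsPiSystem {s | ∃ u v, MeasurableSet[m₁] u ∧ MeasurableSet[m₂] v ∧ u ∩ v = s} := by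
  rintro _ ⟨u, v, hu, hv, rfl⟩ _ ⟨u', v', hu', hv', rfl⟩ -
  exact ⟨u ∩ u', v ∩ v', hu.inter hu', hv.inter hv', Set.inter_inter_inter_comm u u' v v'⟩

end MeasurableSpace

namespace ProbabilityTheory

variable {Ω : Type*} {m m₁ m₂ m₃ mΩ : MeasurableSpace Ω}
  {μ : Measure Ω} [IsFiniteMeasure μ]

theorem integrable_indicator_one {t : Set Ω} (ht : MeasurableSet t) :
    Integrable (t.indicator fun _ => (1 : ℝ)) μ :=
  (integrable_const 1).indicator ht

/-- Pulling a measurable event out of a conditional probability. -/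
theorem condExp_indicator_inter {t s : Set Ω} (ht : MeasurableSet t)
    (hs : MeasurableSet[m] s) :
    μ[(t ∩ s).indicator fun _ => (1 : ℝ) | m] =ᵐ[μ]
      s.indicator (μ[t.indicator fun _ => (1 : ℝ) | m]) := by
  have := condExp_indicator (m := m) (integrable_indicator_one (μ := μ) ht) hs
  rwa [Set.indicator_indicator, Set.inter_comm] at this

variable [StandardBorelSpace Ω]

/-- Conditional independence of two `σ`-algebras given a third one is equivalent to the Markov
property: conditioning further on the second one does not change conditional probabilities of
events in the first one. -/
theorem condIndep_iff_condExp_sup (hm : m ≤ mΩ) (hm₁ : m₁ ≤ mΩ) (hm₂ : m₂ ≤ mΩ) :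
    CondIndep m m₁ m₂ hm μ ↔ ∀ t, MeasurableSet[m₁] t →
      μ[t.indicator fun _ => (1 : ℝ) | m ⊔ m₂] =ᵐ[μ] μ[t.indicator fun _ => (1 : ℝ) | m] := by
  have hs : m ⊔ m₂ ≤ mΩ := sup_le hm hm₂
  rw [condIndep_iff m m₁ m₂ hm hm₁ hm₂]
  constructor
  · intro h t ht
    have hti := integrable_indicator_one (μ := μ) (hm₁ t ht)
    have hmark : StronglyMeasurable[m ⊔ m₂] (μ[t.indicator fun _ => (1 : ℝ) | m]) :=
      stronglyMeasurable_condExp.mono le_sup_left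
    -- By uniqueness of conditional expectation it is enough to compare integrals over sets of `m ⊔
    -- m₂`; a π-λ argument reduces these to intersections `u ∩ v`.
    refine (ae_eq_condExp_of_forall_setIntegral_eq hs hti
      (fun _ _ _ => integrable_condExp.integrableOn) (fun s hs' _ => ?_)
      hmark.aestronglyMeasurable).symm
    induction s, hs' using MeasurableSpace.induction_on_inter
      (MeasurableSpace.sup_eq_generateFrom_inter m m₂) (MeasurableSpace.isPiSystem_inter m m₂) with
    | empty => simp
    | basic s hs' =>
      obtain ⟨u, v, hu, hv, rfl⟩ := hs'
      have hvi := integrable_indicator_one (μ := μ) (hm₂ v hv)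
      have htv := integrable_indicator_one (μ := μ) ((hm₁ t ht).inter (hm₂ v hv))
      have hprod : v.indicator (μ[t.indicator fun _ => (1 : ℝ) | m]) =
          (μ[t.indicator fun _ => (1 : ℝ) | m]) * v.indicator fun _ => (1 : ℝ) := by
        ext ω; by_cases hω : ω ∈ v <;> simp [hω]
      have hpi : Integrable (v.indicator (μ[t.indicator fun _ => (1 : ℝ) | m])) μ :=
        integrable_condExp.indicator (hm₂ v hv)
      -- Both sides are the product of the conditional probabilities of `t` and `v` given `m`: the
      -- left by pulling out, the right by conditional independence.
      have hpull : μ[v.indicator (μ[t.indicator fun _ => (1 : ℝ) | m]) | m] =ᵐ[μ]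
          μ[(t ∩ v).indicator fun _ => (1 : ℝ) | m] := by
        refine Filter.EventuallyEq.trans ?_ (h t v ht hv).symm
        rw [hprod] at hpi ⊢
        exact condExp_mul_of_stronglyMeasurable_left stronglyMeasurable_condExp hpi hvi
      calc ∫ x in u ∩ v, (μ[t.indicator fun _ => (1 : ℝ) | m]) x ∂μ
          = ∫ x in u, v.indicator (μ[t.indicator fun _ => (1 : ℝ) | m]) x ∂μ :=
            (setIntegral_indicator (hm₂ v hv)).symm
        _ = ∫ x in u, (μ[v.indicator (μ[t.indicator fun _ => (1 : ℝ) | m]) | m]) x ∂μ :=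
            (setIntegral_condExp hm hpi hu).symm
        _ = ∫ x in u, (μ[(t ∩ v).indicator fun _ => (1 : ℝ) | m]) x ∂μ :=
            integral_congr_ae (ae_restrict_of_ae hpull)
        _ = ∫ x in u, (t ∩ v).indicator (fun _ => (1 : ℝ)) x ∂μ := setIntegral_condExp hm htv hu
        _ = ∫ x in u, v.indicator (t.indicator fun _ => (1 : ℝ)) x ∂μ := by
            rw [Set.indicator_indicator, Set.inter_comm]
        _ = ∫ x in u ∩ v, t.indicator (fun _ => (1 : ℝ)) x ∂μ := setIntegral_indicator (hm₂ v hv)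
    | compl s hs' ih =>
      have e₁ := integral_add_compl (hs s hs') (integrable_condExp
        (f := t.indicator fun _ => (1 : ℝ)) (m := m) (μ := μ))
      have e₂ := integral_add_compl (hs s hs') hti
      have e₃ := integral_condExp (μ := μ) (f := t.indicator fun _ => (1 : ℝ)) hm
      linarith [ih (measure_lt_top μ s)]
    | iUnion f hd hf ih =>
      rw [integral_iUnion (fun i => hs _ (hf i)) hd integrable_condExp.integrableOn,
        integral_iUnion (fun i => hs _ (hf i)) hd hti.integrableOn]
      exact tsum_congr fun i => ih i (measure_lt_top μ (f i))
  · intro h t₁ t₂ ht₁ ht₂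
    have ht₂i := integrable_indicator_one (μ := μ) (hm₂ t₂ ht₂)
    have hprod : t₂.indicator (μ[t₁.indicator fun _ => (1 : ℝ) | m]) =
        (μ[t₁.indicator fun _ => (1 : ℝ) | m]) * t₂.indicator fun _ => (1 : ℝ) := by
      ext ω; by_cases hω : ω ∈ t₂ <;> simp [hω]
    have hpi : Integrable (t₂.indicator (μ[t₁.indicator fun _ => (1 : ℝ) | m])) μ :=
      integrable_condExp.indicator (hm₂ t₂ ht₂)
    have e₁ := condExp_indicator_inter (μ := μ) (hm₁ t₁ ht₁)
      ((le_sup_right : m₂ ≤ m ⊔ m₂) t₂ ht₂)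
    have e₂ : t₂.indicator (μ[t₁.indicator fun _ => (1 : ℝ) | m ⊔ m₂]) =ᵐ[μ]
        t₂.indicator (μ[t₁.indicator fun _ => (1 : ℝ) | m]) := by
      filter_upwards [h t₁ ht₁] with ω hω
      by_cases hω' : ω ∈ t₂ <;> simp [hω', hω]
    -- Tower property through `m ⊔ m₂`, where `t₂` is measurable and can be pulled out.
    calc μ[(t₁ ∩ t₂).indicator fun _ => (1 : ℝ) | m]
        =ᵐ[μ] μ[μ[(t₁ ∩ t₂).indicator fun _ => (1 : ℝ) | m ⊔ m₂] | m] :=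
          (condExp_condExp_of_le le_sup_left hs).symm
      _ =ᵐ[μ] μ[t₂.indicator (μ[t₁.indicator fun _ => (1 : ℝ) | m]) | m] :=
          condExp_congr_ae (e₁.trans e₂)
      _ =ᵐ[μ] _ := by
          rw [hprod] at hpi ⊢
          exact condExp_mul_of_stronglyMeasurable_left stronglyMeasurable_condExp hpi ht₂i

/-- The weak union property of conditional independence. -/
theorem CondIndep.weak_union {hm : m ≤ mΩ} (hm₁ : m₁ ≤ mΩ) (hm₂ : m₂ ≤ mΩ) (hm₃ : m₃ ≤ mΩ)
    (h : CondIndep m m₁ (m₂ ⊔ m₃) hm μ) : CondIndep (m ⊔ m₃) m₁ m₂ (sup_le hm hm₃) μ := by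
  have h₃ := (condIndep_iff_condExp_sup hm hm₁ hm₃).1
    (condIndep_of_condIndep_of_le_right h le_sup_right)
  rw [condIndep_iff_condExp_sup hm hm₁ (sup_le hm₂ hm₃)] at h
  rw [condIndep_iff_condExp_sup (sup_le hm hm₃) hm₁ hm₂]
  intro t ht
  rw [sup_assoc, sup_comm m₃ m₂]
  -- Given `m ⊔ m₂ ⊔ m₃` or `m ⊔ m₃`, the conditional probability of `t` is in both cases the one
  -- given `m`.
  exact (h t ht).trans (h₃ t ht).symm

/-- A conditionally independent `σ`-algebra may be enlarged by the one conditioned on. -/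
theorem CondIndep.sup_right {hm : m ≤ mΩ} (hm₁ : m₁ ≤ mΩ) (hm₂ : m₂ ≤ mΩ)
    (h : CondIndep m m₁ m₂ hm μ) : CondIndep m m₁ (m ⊔ m₂) hm μ := by
  rw [condIndep_iff_condExp_sup hm hm₁ hm₂] at h
  rw [condIndep_iff_condExp_sup hm hm₁ (sup_le hm hm₂), ← sup_assoc, sup_idem]
  exact h

/-- Independence of `m₂` from a `σ`-algebra containing both `m` and `m₁` entails conditional
independence of `m₁` and `m₂` given `m`. -/
theorem condIndep_of_indep [IsProbabilityMeasure μ] (hm₂ : m₂ ≤ mΩ) (hm₃ : m₃ ≤ mΩ)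
    (h : m ≤ m₃) (h₁ : m₁ ≤ m₃) (hind : Indep m₂ m₃ μ) : CondIndep m m₁ m₂ (h.trans hm₃) μ := by
  -- After exchanging the roles, the event lies in `m₂`, and both of its conditional probabilities
  -- are the same constant.
  refine CondIndep.symm ((condIndep_iff_condExp_sup _ hm₂ (h₁.trans hm₃)).2 fun t ht => ?_)
  have hsm : StronglyMeasurable[m₂] (t.indicator fun _ => (1 : ℝ)) :=
    stronglyMeasurable_const.indicator ht
  exact (condExp_indep_eq hm₂ ((sup_le h h₁).trans hm₃) hsm
    (indep_of_indep_of_le_right hind (sup_le h h₁))).trans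
    (condExp_indep_eq hm₂ (h.trans hm₃) hsm (indep_of_indep_of_le_right hind h)).symm

end ProbabilityTheory

noncomputable section

/-! ### Variables, potential variables and their σ-algebras -/

namespace StructuralModel

variable {V : Type u} {G : CausalDiagram V} (M : StructuralModel G)

theorem measurable_f_comp {α : Type*} [MeasurableSpace α] (v : V)
    {g : α → ∀ p : {p // G.Adj p v}, M.Val p} {e : α → M.Noise v}
    (hg : ∀ p, Measurable fun x => g x p) (he : Measurable e) :
    Measurable fun x => M.f v (g x) (e x) :=
  (M.measurable_f v).comp ((measurable_pi_lambda _ hg).prodMk he)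

/-- The `σ`-algebra generated by all disturbances other than that of `A`. -/
abbrev sigmaNoiseCompl (A : V) : MeasurableSpace M.Ω :=
  ⨆ w ∈ ({A}ᶜ : Set V), MeasurableSpace.comap (fun ε : M.Ω => ε w) inferInstance

theorem measurable_apply_sigmaNoiseCompl {A w : V} (h : w ≠ A) :
    Measurable[M.sigmaNoiseCompl A] fun ε : M.Ω => ε w :=
  measurable_iff_comap_le.2 (le_iSup₂_of_le w h le_rfl)

theorem sigmaNoiseCompl_le_pi (A : V) : M.sigmaNoiseCompl A ≤ MeasurableSpace.pi :=
  iSup₂_le fun w _ => (measurable_pi_apply w).comap_le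

variable [Fintype V]

theorem X_eq (v : V) (ε : M.Ω) : M.X v ε = M.f v (fun p => M.X p.1 ε) (ε v) :=
  M.solve_eq _ v

open Classical in
theorem potential_self (A : V) (a : M.Val A) (ε : M.Ω) : M.potential A a A ε = a := by
  unfold potential
  rw [solve_eq, Function.update_self]

open Classical in
theorem potential_of_ne {A v : V} (a : M.Val A) (h : v ≠ A) (ε : M.Ω) :
    M.potential A a v ε = M.f v (fun p => M.potential A a p.1 ε) (ε v) := by
  unfold potential
  rw [solve_eq, Function.update_of_ne h]

/-- An intervention has no effect on nondescendants. -/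
theorem potential_eq_X {A v : V} (a : M.Val A) (h : v ≠ A) (hv : ¬ G.IsAncestor A v) :
    M.potential A a v = M.X v := by
  induction v using G.wellFounded_adj.induction with
  | _ v ih =>
    funext ε
    rw [M.potential_of_ne a h, M.X_eq]
    congr 1
    funext p
    rw [ih p.1 p.2]
    · rintro rfl
      exact hv (Relation.TransGen.single p.2)
    · exact fun hp => hv (Relation.TransGen.tail hp p.2)

theorem measurable_potential (A : V) (a : M.Val A) (v : V) : Measurable (M.potential A a v) := by
  induction v using G.wellFounded_adj.induction with
  | _ v ih =>
    by_cases h : v = A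
    · subst h
      rw [show M.potential v a v = fun _ => a from funext (M.potential_self v a)]
      exact measurable_const
    · rw [show M.potential A a v = _ from funext (M.potential_of_ne a h)]
      exact M.measurable_f_comp v (fun p => ih p.1 p.2) (measurable_pi_apply v)

/-- The `σ`-algebra generated by a variable. -/
abbrev sigma (v : V) : MeasurableSpace M.Ω := MeasurableSpace.comap (M.X v) inferInstance

/-- The `σ`-algebra generated by a potential variable. -/
abbrev sigmaPotential (A : V) (a : M.Val A) (v : V) : MeasurableSpace M.Ω :=
  MeasurableSpace.comap (M.potential A a v) inferInstance

theorem comap_XOn (S : Set V) :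
    MeasurableSpace.comap (M.XOn S) inferInstance = ⨆ s : S, M.sigma s := by
  change MeasurableSpace.comap (M.XOn S) MeasurableSpace.pi = _
  simp only [MeasurableSpace.pi, MeasurableSpace.comap_iSup, MeasurableSpace.comap_comp]
  rfl

theorem sigma_le_pi (v : V) : M.sigma v ≤ MeasurableSpace.pi := (M.measurable_X v).comap_le

theorem sigmaPotential_le_pi (A : V) (a : M.Val A) (v : V) :
    M.sigmaPotential A a v ≤ MeasurableSpace.pi := (M.measurable_potential A a v).comap_le

theorem iSup_sigma_le_pi (S : Set V) : ⨆ s : S, M.sigma s ≤ MeasurableSpace.pi :=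
  iSup_le fun s => M.sigma_le_pi s

theorem iSup_sigma_insert (t : V) (S : Set V) :
    ⨆ s : ↥(insert t S), M.sigma s = (⨆ s : S, M.sigma s) ⊔ M.sigma t := by
  rw [iSup_subtype, iSup_subtype, sup_comm]
  exact iSup_insert

/-- Unconfoundedness in terms of `σ`-algebras. -/
theorem unconfounded_iff (A Y : V) (S : Set V) :
    M.Unconfounded A Y S ↔ ∀ a, CondIndep (⨆ s : S, M.sigma s) (M.sigmaPotential A a Y)
      (M.sigma A) (M.iSup_sigma_le_pi S) M.law := by
  refine forall_congr' fun a => ?_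
  rw [condIndepFun_iff_condIndep]
  simp only [M.comap_XOn S]

/-- Unconfoundedness given `S` passes to any `σ`-algebra generated by `S`. -/
theorem Unconfounded.condIndep {M : StructuralModel G} {A Y : V} {S : Set V}
    (h : M.Unconfounded A Y S) (a : M.Val A)
    {m : MeasurableSpace M.Ω} (hm : m ≤ MeasurableSpace.pi) (hS : ⨆ s : S, M.sigma s = m) :
    CondIndep m (M.sigmaPotential A a Y) (M.sigma A) hm M.law := by
  subst hS
  exact (M.unconfounded_iff A Y S).1 h a

/-! ### Freezing the equations outside an ancestral set -/

open Classical in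
/-- The model in which the equations outside `B` are replaced by the constants `c`. -/
abbrev freeze (B : Set V) (c : ∀ v, M.Val v) : StructuralModel G where
  Val := M.Val
  Noise := M.Noise
  noiseLaw := M.noiseLaw
  f v pa e := if v ∈ B then M.f v pa e else c v
  measurable_f v := by
    by_cases h : v ∈ B
    · simpa only [h, if_true] using M.measurable_f v
    · simp only [h, if_false]
      exact measurable_const

theorem freeze_X_of_mem {B : Set V} (hB : ∀ u v, G.Adj u v → v ∈ B → u ∈ B)
    (c : ∀ v, M.Val v) {v : V} (hv : v ∈ B) : (M.freeze B c).X v = M.X v := by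
  induction v using G.wellFounded_adj.induction with
  | _ v ih =>
    funext ε
    refine ((M.freeze B c).X_eq v ε).trans ((if_pos hv).trans (Eq.trans ?_ (M.X_eq v ε).symm))
    congr 1
    funext p
    rw [ih p.1 p.2 (hB _ _ p.2 hv)]

theorem freeze_X_of_notMem (B : Set V) (c : ∀ v, M.Val v) {v : V} (hv : v ∉ B) :
    (M.freeze B c).X v = fun _ => c v := by
  funext ε
  rw [X_eq]
  exact if_neg hv

theorem freeze_potential_of_mem {B : Set V} (hB : ∀ u v, G.Adj u v → v ∈ B → u ∈ B)
    (c : ∀ v, M.Val v) {A v : V} (a : M.Val A) (hv : v ∈ B) :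
    (M.freeze B c).potential A a v = M.potential A a v := by
  induction v using G.wellFounded_adj.induction with
  | _ v ih =>
    funext ε
    by_cases h : v = A
    · subst h
      exact ((M.freeze B c).potential_self v a ε).trans (M.potential_self v a ε).symm
    · refine ((M.freeze B c).potential_of_ne a h ε).trans
        ((if_pos hv).trans (Eq.trans ?_ (M.potential_of_ne a h ε).symm))
      congr 1
      funext p
      rw [ih p.1 p.2 (hB _ _ p.2 hv)]

/-! ### Broadcasting a variable to its descendants -/

open Classical in
/-- The model in which every variable `v` carries as a second coordinate a copy of the variable
`t`, obtained from the parent `par v` if there is one, and the constant `c` otherwise. -/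
abbrev broadcast (t : V) (par : ∀ v, Option {p // G.Adj p v}) (c : M.Val t) :
    StructuralModel G where
  Val v := M.Val v × M.Val t
  Noise := M.Noise
  noiseLaw := M.noiseLaw
  f v pa e := (M.f v (fun p => (pa p).1) e,
    if h : v = t then h ▸ M.f v (fun p => (pa p).1) e
    else (par v).elim c fun p => (pa p).2)
  measurable_f v := by
    have h₁ : Measurable fun x : (∀ p : {p // G.Adj p v}, M.Val p × M.Val t) × M.Noise v =>
        M.f v (fun p => (x.1 p).1) x.2 :=
      M.measurable_f_comp v (fun p => ((measurable_pi_apply p).comp measurable_fst).fst)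
        measurable_snd
    refine h₁.prodMk ?_
    by_cases h : v = t
    · subst h
      simpa using h₁
    · simp only [h, dite_false]
      cases par v with
      | none => exact measurable_const
      | some p => exact ((measurable_pi_apply p).comp measurable_fst).snd

section broadcast

variable {t : V} {par : ∀ v, Option {p // G.Adj p v}} {W : Set V}

-- The copies do reach all of `W`: following `par` backwards from a vertex of `W` stays in `W` and,
-- by acyclicity, ends at `t`.
open Classical in
theorem broadcast_X (c : M.Val t) (ht : t ∈ W) (hpar : ∀ v ∈ W, v ≠ t → ∃ p ∈ par v, p.1 ∈ W)
    (hnone : ∀ v ∉ W, par v = none) (v : V) (ε : M.Ω) :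
    (M.broadcast t par c).X v ε = (M.X v ε, if v ∈ W then M.X t ε else c) := by
  induction v using G.wellFounded_adj.induction with
  | _ v ih =>
    have hf : (fun p : {p // G.Adj p v} => ((M.broadcast t par c).X p.1 ε).1) =
        fun p : {p // G.Adj p v} => M.X p.1 ε := by
      funext p
      rw [ih p.1 p.2]
    refine ((M.broadcast t par c).X_eq v ε).trans ?_
    refine Prod.ext ?_ ?_
    · change M.f v (fun p => ((M.broadcast t par c).X p.1 ε).1) (ε v) = _
      rw [hf, ← X_eq]
    · change (if h : v = t then h ▸ M.f v (fun p => ((M.broadcast t par c).X p.1 ε).1) (ε v)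
        else (par v).elim c fun p => ((M.broadcast t par c).X p.1 ε).2) = _
      rw [hf, ← X_eq]
      by_cases h : v = t
      · subst h
        simp [ht]
      · rw [dif_neg h]
        by_cases hv : v ∈ W
        · obtain ⟨p, hp, hpW⟩ := hpar v hv h
          rw [Option.mem_def] at hp
          simp only [hp, Option.elim_some, hv, if_true]
          rw [ih p.1 p.2]
          exact if_pos hpW
        · simp [hnone v hv, hv]

-- The intervention overwrites the copy held by `A` with `c`. The copies elsewhere in `W` survive
-- because none of them is received from `A`.
open Classical in
theorem broadcast_potential {A : V} (a : M.Val A) (c : M.Val t) (htA : t ≠ A) (ht : t ∈ W)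
    (hpar : ∀ v ∈ W, v ≠ t → ∃ p ∈ par v, p.1 ∈ W ∧ p.1 ≠ A) (hnone : ∀ v ∉ W, par v = none)
    (v : V) (ε : M.Ω) :
    (M.broadcast t par c).potential A (a, c) v ε =
      (M.potential A a v ε, if v ∈ W ∧ v ≠ A then M.potential A a t ε else c) := by
  induction v using G.wellFounded_adj.induction with
  | _ v ih =>
    by_cases hvA : v = A
    · subst hvA
      refine ((M.broadcast t par c).potential_self v (a, c) ε).trans ?_
      simp [potential_self]
    have hf : (fun p : {p // G.Adj p v} => ((M.broadcast t par c).potential A (a, c) p.1 ε).1) =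
        fun p : {p // G.Adj p v} => M.potential A a p.1 ε := by
      funext p
      rw [ih p.1 p.2]
    refine ((M.broadcast t par c).potential_of_ne (a, c) hvA ε).trans ?_
    refine Prod.ext ?_ ?_
    · change M.f v (fun p => ((M.broadcast t par c).potential A (a, c) p.1 ε).1) (ε v) = _
      rw [hf, ← potential_of_ne _ _ hvA]
    · change (if h : v = t then
          h ▸ M.f v (fun p => ((M.broadcast t par c).potential A (a, c) p.1 ε).1) (ε v)
        else (par v).elim c fun p => ((M.broadcast t par c).potential A (a, c) p.1 ε).2) = _
      rw [hf, ← potential_of_ne _ _ hvA]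
      by_cases h : v = t
      · subst h
        simp [ht, hvA]
      · rw [dif_neg h]
        by_cases hv : v ∈ W
        · obtain ⟨p, hp, hpW⟩ := hpar v hv h
          rw [Option.mem_def] at hp
          simp only [hp, Option.elim_some]
          rw [ih p.1 p.2, if_pos hpW, if_pos ⟨hv, hvA⟩]
        · simp [hnone v hv, hv]

end broadcast

/-! ### Adjusting for the parents of the exposure -/

theorem indep_sigmaNoiseCompl (A : V) :
    Indep (MeasurableSpace.comap (fun ε : M.Ω => ε A) inferInstance) (M.sigmaNoiseCompl A)
      M.law := by
  have h : iIndepFun (fun (w : V) (ε : M.Ω) => ε w) M.law :=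
    iIndepFun_pi (X := fun _ x => x) fun _ => aemeasurable_id
  have hdisj := indep_iSup_of_disjoint (fun w => (measurable_pi_apply w).comap_le) h
    (S := {A}) (T := {A}ᶜ) disjoint_compl_right
  rwa [iSup_singleton] at hdisj

/-- Potential variables do not depend on the disturbance of the exposure. -/
theorem sigmaPotential_le_sigmaNoiseCompl (A : V) (a : M.Val A) (v : V) :
    M.sigmaPotential A a v ≤ M.sigmaNoiseCompl A := by
  rw [← measurable_iff_comap_le]
  induction v using G.wellFounded_adj.induction with
  | _ v ih =>
    by_cases h : v = A
    · subst h
      rw [show M.potential v a v = fun _ => a from funext (M.potential_self v a)]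
      exact measurable_const
    · rw [show M.potential A a v = _ from funext (M.potential_of_ne a h)]
      -- As a local instance, this makes the measurability of `f` apply to the smaller σ-algebra.
      let _ := M.sigmaNoiseCompl A
      exact M.measurable_f_comp v (fun p => ih p.1 p.2) (M.measurable_apply_sigmaNoiseCompl h)

theorem sigma_le_parents_sup_noise (A : V) :
    M.sigma A ≤ (⨆ s : {p | G.Adj p A}, M.sigma s) ⊔
      MeasurableSpace.comap (fun ε : M.Ω => ε A) inferInstance := by
  rw [← measurable_iff_comap_le, show M.X A = _ from funext (M.X_eq A)]
  refine @measurable_f_comp _ _ M _ (_ ⊔ _) A _ _ (fun p => ?_) ?_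
  · exact measurable_iff_comap_le.2
      ((le_iSup (fun s : {p | G.Adj p A} => M.sigma s) p).trans le_sup_left)
  · exact measurable_iff_comap_le.2 le_sup_right

/-- Given its parents, `A` varies only through its own disturbance, which is independent of the
other disturbances; these determine both the parents and `Y_a`. -/
theorem unconfounded_parents (A Y : V) : M.Unconfounded A Y {p | G.Adj p A} := by
  rw [unconfounded_iff]
  intro a
  have hpar : ⨆ s : {p | G.Adj p A}, M.sigma s ≤ M.sigmaNoiseCompl A := by
    refine iSup_le fun s => ?_
    have hs : ¬ G.IsAncestor A s := fun h => G.acyclic A (Relation.TransGen.tail h s.2)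
    have hsA : s.1 ≠ A := fun h =>
      G.acyclic A (Relation.TransGen.single (by simpa [h] using s.2))
    have := M.sigmaPotential_le_sigmaNoiseCompl A a s
    rwa [sigmaPotential, M.potential_eq_X a hsA hs] at this
  have hA : MeasurableSpace.comap (fun ε : M.Ω => ε A) inferInstance ≤ MeasurableSpace.pi :=
    (measurable_pi_apply A).comap_le
  have h := condIndep_of_indep hA (M.sigmaNoiseCompl_le_pi A) hpar
    (M.sigmaPotential_le_sigmaNoiseCompl A a Y) (M.indep_sigmaNoiseCompl A)
  exact condIndep_of_condIndep_of_le_right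
    (h.sup_right (M.sigmaPotential_le_pi A a Y) hA) (M.sigma_le_parents_sup_noise A)

/-- A point of the disturbance space supplies the constants used in freezing and broadcasting. -/
instance : Nonempty M.Ω := M.law.nonempty_of_neZero

end StructuralModel

/-! ### Operations on sufficient sets and the union of the minimal ones -/

namespace CausalDiagram

open StructuralModel

variable {V : Type u} {G : CausalDiagram V} {A Y t : V} {B S : Set V}

/-- A directed path out of `t` that meets `D` has a first vertex in `D`. -/
theorem exists_first_hit {D : Set V} {e : V} (he : e ∈ D)
    (h : Relation.ReflTransGen G.Adj t e) :
    ∃ e ∈ D, Relation.ReflTransGen (fun u v => G.Adj u v ∧ u ∉ D) t e := by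
  induction h using Relation.ReflTransGen.head_induction_on with
  | refl => exact ⟨e, he, Relation.ReflTransGen.refl⟩
  | @head b c hab _ ih =>
    by_cases hb : b ∈ D
    · exact ⟨b, hb, Relation.ReflTransGen.refl⟩
    · obtain ⟨d, hd, hcd⟩ := ih
      exact ⟨d, hd, Relation.ReflTransGen.head ⟨hab, hb⟩ hcd⟩

variable [Fintype V]

/-- Restricting a sufficient set to an ancestral set that contains exposure and outcome. -/
theorem Sufficient.inter_ancestral (hB : ∀ u v, G.Adj u v → v ∈ B → u ∈ B) (hA : A ∈ B)
    (hY : Y ∈ B) (h : G.Sufficient A Y S) : G.Sufficient A Y (S ∩ B) := by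
  intro M
  rw [unconfounded_iff]
  intro a
  obtain ⟨ε₀⟩ : Nonempty M.Ω := inferInstance
  let c : ∀ v, M.Val v := fun v => M.X v ε₀
  have hS : ⨆ s : S, (M.freeze B c).sigma s = ⨆ s : ↥(S ∩ B), M.sigma s := by
    apply le_antisymm
    · refine iSup_le fun s => ?_
      by_cases hs : s.1 ∈ B
      · rw [sigma, M.freeze_X_of_mem hB c hs]
        exact le_iSup (fun s : ↥(S ∩ B) => M.sigma s) ⟨s, s.2, hs⟩
      · rw [sigma, M.freeze_X_of_notMem B c hs, MeasurableSpace.comap_const]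
        exact bot_le
    · refine iSup_le fun s => ?_
      have := le_iSup (fun s : S => (M.freeze B c).sigma s) ⟨s, s.2.1⟩
      rwa [sigma, M.freeze_X_of_mem hB c s.2.2] at this
  have := (h (M.freeze B c)).condIndep a (M.iSup_sigma_le_pi _) hS
  rwa [sigma, sigmaPotential, M.freeze_X_of_mem hB c hA,
    M.freeze_potential_of_mem hB c a hY] at this

open Classical in
/-- A sufficient set may be enlarged by a nondescendant of the exposure that is an ancestor of the
exposure or of the outcome. -/
theorem Sufficient.insert (h : G.Sufficient A Y S) (htA : t ≠ A) (hnd : ¬ G.IsAncestor A t)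
    (hanc : Relation.ReflTransGen G.Adj t A ∨ Relation.ReflTransGen G.Adj t Y) (hAY : A ≠ Y) :
    G.Sufficient A Y (insert t S) := by
  -- Copies of `X_t` stop at the first vertex of `D`; `W` is the set of vertices they reach.
  let D : Set V := {e | e ∈ S ∨ e = A ∨ e = Y}
  let R : V → V → Prop := fun u v => G.Adj u v ∧ u ∉ D
  let W : Set V := {v | Relation.ReflTransGen R t v}
  have ht : t ∈ W := Relation.ReflTransGen.refl
  -- A predecessor on such a path lies outside `D`, so it is never `A`.
  have hex : ∀ v ∈ W, v ≠ t → ∃ p : {p // G.Adj p v}, p.1 ∈ W ∧ p.1 ≠ A := by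
    intro v hv hvt
    obtain rfl | ⟨p, hp, hpv, hpD⟩ := Relation.ReflTransGen.cases_tail hv
    · exact absurd rfl hvt
    · exact ⟨⟨p, hpv⟩, hp, fun hpA => hpD (Or.inr (Or.inl hpA))⟩
  let par : ∀ v, Option {p // G.Adj p v} := fun v =>
    if hv : v ∈ W ∧ v ≠ t then some (hex v hv.1 hv.2).choose else none
  have hpar : ∀ v ∈ W, v ≠ t → ∃ p ∈ par v, p.1 ∈ W ∧ p.1 ≠ A := fun v hv hvt =>
    ⟨_, dif_pos ⟨hv, hvt⟩, (hex v hv hvt).choose_spec⟩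
  have hpar' : ∀ v ∈ W, v ≠ t → ∃ p ∈ par v, p.1 ∈ W := fun v hv hvt =>
    (hpar v hv hvt).imp fun _ hp => ⟨hp.1, hp.2.1⟩
  have hnone : ∀ v ∉ W, par v = none := fun v hv => dif_neg fun h => hv h.1
  intro M
  rw [unconfounded_iff]
  intro a
  obtain ⟨ε₀⟩ : Nonempty M.Ω := inferInstance
  let c : M.Val t := M.X t ε₀
  let N := M.broadcast t par c
  have hX : ∀ v, N.sigma v = M.sigma v ⊔ if v ∈ W then M.sigma t else ⊥ := by
    intro v
    have hv := funext fun ε => M.broadcast_X c ht hpar' hnone v ε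
    split_ifs with hvW
    · simp only [hvW, if_true] at hv
      exact (congrArg (MeasurableSpace.comap · inferInstance) hv).trans
        (MeasurableSpace.comap_prodMk _ _)
    · simp only [hvW, if_false] at hv
      refine (congrArg (MeasurableSpace.comap · inferInstance) hv).trans
        ((MeasurableSpace.comap_prodMk _ _).trans ?_)
      rw [MeasurableSpace.comap_const]
  have hYpot : N.sigmaPotential A (a, c) Y =
      M.sigmaPotential A a Y ⊔ if Y ∈ W then M.sigma t else ⊥ := by
    have hv := funext fun ε => M.broadcast_potential a c htA ht hpar hnone Y ε
    -- The copy under intervention is the actual `X_t`, since `t` is a nondescendant of `A`.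
    rw [M.potential_eq_X a htA hnd] at hv
    split_ifs with hYW
    · simp only [hYW, hAY.symm, ne_eq, not_false_eq_true, and_self, if_true] at hv
      exact (congrArg (MeasurableSpace.comap · inferInstance) hv).trans
        (MeasurableSpace.comap_prodMk _ _)
    · simp only [hYW, false_and, if_false] at hv
      refine (congrArg (MeasurableSpace.comap · inferInstance) hv).trans
        ((MeasurableSpace.comap_prodMk _ _).trans ?_)
      rw [MeasurableSpace.comap_const]
  have hind {m : MeasurableSpace M.Ω} (hm : m ≤ MeasurableSpace.pi)
      (hS : ⨆ s : S, N.sigma s = m) :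
      CondIndep m (M.sigmaPotential A a Y ⊔ if Y ∈ W then M.sigma t else ⊥)
        (M.sigma A ⊔ if A ∈ W then M.sigma t else ⊥) hm M.law := by
    have := (h N).condIndep (a, c) hm hS
    rw [hYpot, hX] at this
    exact this
  have hYle := M.sigmaPotential_le_pi A a Y
  have hAle := M.sigma_le_pi A
  have htle := M.sigma_le_pi t
  -- If a copy reaches `S`, conditioning on `S` in `N` is conditioning on `S` and `t` in `M`, and
  -- any copies at `A` or `Y` can be dropped.
  by_cases hSW : ∃ s ∈ S, s ∈ W
  · obtain ⟨s, hs, hsW⟩ := hSW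
    refine condIndep_of_condIndep_of_le_left (condIndep_of_condIndep_of_le_right
      (hind (M.iSup_sigma_le_pi _) ?_) le_sup_left) le_sup_left
    rw [iSup_sigma_insert]
    simp only [hX]
    apply le_antisymm
    · refine iSup_le fun s => sup_le_sup (le_iSup (fun s : S => M.sigma s) s) ?_
      split_ifs
      exacts [le_rfl, bot_le]
    · refine sup_le (iSup_mono fun s => le_sup_left) ?_
      refine le_trans ?_ (le_iSup _ ⟨s, hs⟩)
      rw [if_pos hsW]
      exact le_sup_right
  -- Otherwise conditioning on `S` is unchanged and a copy reaches `A` or `Y`. Weak union moves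
  -- `X_t` from that side into the condition.
  · have hS : ⨆ s : S, N.sigma s = ⨆ s : S, M.sigma s := by
      refine iSup_congr fun s => ?_
      rw [hX, if_neg fun hs => hSW ⟨s, s.2, hs⟩, sup_bot_eq]
    have hc := hind (M.iSup_sigma_le_pi S) hS
    obtain ⟨e, he, heW⟩ : ∃ e ∈ D, e ∈ W := by
      rcases hanc with hanc | hanc
      · exact exists_first_hit (Or.inr (Or.inl rfl)) hanc
      · exact exists_first_hit (Or.inr (Or.inr rfl)) hanc
    simp only [M.iSup_sigma_insert t S]
    rcases he with he | rfl | rfl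
    · exact absurd ⟨e, he, heW⟩ hSW
    · rw [if_pos heW] at hc
      exact (condIndep_of_condIndep_of_le_left hc le_sup_left).weak_union hYle hAle htle
    · rw [if_pos heW] at hc
      exact ((condIndep_of_condIndep_of_le_right hc le_sup_left).symm.weak_union
        hAle hYle htle).symm

/-- Every sufficient set of covariates contains a minimally sufficient one. -/
theorem exists_minimallySufficient {P : Set V} (hSP : S ⊆ P) (h : G.Sufficient A Y S) :
    ∃ T, G.MinimallySufficient A Y P T := by
  induction S using (wellFounded_lt (α := Set V)).induction with
  | _ S ih =>
    by_cases hmin : ∃ T, T ⊂ S ∧ G.Sufficient A Y T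
    · obtain ⟨T, hT, hTs⟩ := hmin
      exact ih T hT (hT.subset.trans hSP) hTs
    · exact ⟨S, hSP, h, fun T hT hTs => hmin ⟨T, hT, hTs⟩⟩

/-- A minimally sufficient set consists of ancestors of the exposure or of the outcome. -/
theorem MinimallySufficient.subset_ancestors {P : Set V} (h : G.MinimallySufficient A Y P S) :
    S ⊆ {v | Relation.ReflTransGen G.Adj v A ∨ Relation.ReflTransGen G.Adj v Y} := by
  by_contra hS
  -- Otherwise the ancestral part of `S` would be a sufficient proper subset.
  refine h.2.2 _ ?_ (h.2.1.inter_ancestral (B := {v | Relation.ReflTransGen G.Adj v A ∨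
    Relation.ReflTransGen G.Adj v Y}) ?_ (Or.inl .refl) (Or.inr .refl))
  · exact Set.inter_ssubset_left_iff.2 hS
  · rintro u v huv (hv | hv)
    exacts [Or.inl (.head huv hv), Or.inr (.head huv hv)]

/-- A union of sufficient sets need not be sufficient for formal reasons; what helps is that every
member of the union may be inserted singly, starting from one minimally sufficient `S₀` obtained
from the parents of `A`. -/
theorem sufficient_sUnion_minimallySufficient (hAY : A ≠ Y) {P : Set V}
    (hP : G.IsPreExposure A Y P) :
    G.Sufficient A Y (⋃₀ {S | G.MinimallySufficient A Y P S}) := by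
  obtain ⟨S₀, hS₀⟩ := exists_minimallySufficient (P := P)
    (fun p hp => hP.ancestor_mem p (Relation.TransGen.single hp))
    (fun M => M.unconfounded_parents A Y)
  -- Taking `T` to be the whole union, which already contains `S₀`, gives the claim.
  have key : ∀ T : Set V, T ⊆ ⋃₀ {S | G.MinimallySufficient A Y P S} →
      G.Sufficient A Y (T ∪ S₀) := by
    intro T
    induction T, T.toFinite using Set.Finite.induction_on with
    | empty => exact fun _ => by simpa using hS₀.2.1
    | @insert t T _ _ ih =>
      intro hT
      obtain ⟨S, hS, htS⟩ := hT (Set.mem_insert t T)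
      have htP := hS.1 htS
      rw [Set.insert_union]
      exact (ih ((Set.subset_insert t T).trans hT)).insert
        (fun h => hP.exposure_notMem (h ▸ htP)) (hP.not_descendant t htP)
        (hS.subset_ancestors htS) hAY
  have := key _ subset_rfl
  rwa [Set.union_eq_self_of_subset_right (Set.subset_sUnion_of_mem hS₀)] at this

theorem setOf_isConfounder (G : CausalDiagram V) (A Y : V) (P : Set V) :
    {C | G.IsConfounder A Y P C} = ⋃₀ {S | G.MinimallySufficient A Y P S} := by
  ext C
  exact ⟨fun ⟨_, S, hS, hC⟩ => ⟨S, hS, hC⟩, fun ⟨S, hS, hC⟩ => ⟨hS.1 hC, S, hS, hC⟩⟩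

/-- The witness is `S \ {C}` for a minimally sufficient `S` containing `C`: restoring `C` gives `S`,
and omitting it contradicts minimality. -/
theorem confoundersEliminateBias (G : CausalDiagram V) (A Y : V) (P : Set V) :
    G.ConfoundersEliminateBias A Y P (G.IsConfounder A Y P) := by
  rintro C ⟨_, S, hS, hC⟩
  refine ⟨S \ {C}, Set.sdiff_subset.trans hS.1, ?_, hS.2.2 _ (Set.sdiff_singleton_ssubset.2 hC)⟩
  rw [Set.insert_sdiff_singleton, Set.insert_eq_of_mem hC]
  exact hS.2.1

end CausalDiagram

end

theorem proposition4 {V : Type*} [Fintype V] (G : CausalDiagram V) (A Y : V) (hAY : A ≠ Y)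
    (P : Set V) (hP : G.IsPreExposure A Y P) :
    G.ConfoundersSuffice A Y (G.IsConfounder A Y P) ∧
      G.Sufficient A Y (⋃₀ {S | G.MinimallySufficient A Y P S}) ∧
      G.ConfoundersEliminateBias A Y P (G.IsConfounder A Y P) := by
  have h := CausalDiagram.sufficient_sUnion_minimallySufficient hAY hP
  refine ⟨?_, h, G.confoundersEliminateBias A Y P⟩
  rwa [CausalDiagram.ConfoundersSuffice, G.setOf_isConfounder]
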